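/- Let $A$ be a finite set of agents and $P$ a countable set of propositional variables (given with an effective enumeration). The formulas of asynchronous announcement logic are $$\phi ::= p \mid \neg\phi \mid \phi\wedge\phi \mid K_a\phi \mid [\phi]\phi \mid X_a\phi \qquad (a\in A,\ p\in P).$$ An epistemic model $(S,\sim,V)$ consists of a non-empty set $S$, an equivalence relation $\sim_a$ on $S$ for each $a\in A$, and a valuation $V:P\to\mathcal P(S)$. Fix such a model. For $s\in S$, a finite sequence of formulas $\vec\phi$ (the announcements sent so far) and a cut $f:A\to\{0,\dots,|\vec\phi|\}$ (the number of announcements each agent has received), being an asynchronous model and truth are defined by simultaneous recursion. Asynchronous models are generated by the following clauses: (1) $(s,\epsilon,f_0)$ is an asynchronous model, where $\epsilon$ is the empty sequence and $f_0=0$; such a model is called initial; (2) if $(s,\vec\phi,f)$ is an asynchronous model and $(s,\vec\phi,f)\models\phi$, then $(s,\vec\phi.\phi,f)$ is an asynchronous model; (3) if $(s,\vec\phi,f)$ is an asynchronous model and $f(a)<|\vec\phi|$, then $(s,\vec\phi,f^{+a})$ is an asynchronous model, where $f^{+a}(a)=f(a)+1$ and $f^{+a}(b)=f(b)$ for $b\ne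 a$. Truth is defined by: $(s,\vec\phi,f)\models p$ iff $s\in V(p)$; negation and conjunction are Boolean; $(s,\vec\phi,f)\models K_a\phi$ iff $(t,\vec\phi,g)\models\phi$ for all $t\sim_a s$ and all cuts $g$ with $g(a)=f(a)$ and $g(b)\le f(a)$ for every $b\neq a$ such that $(t,\vec\phi,g)$ is an asynchronous model; $(s,\vec\phi,f)\models[\psi]\phi$ iff $(s,\vec\phi,f)\models\psi$ implies $(s,\vec\phi.\psi,f)\models\phi$; $(s,\vec\phi,f)\models X_a\phi$ iff $f(a)<|\vec\phi|$ implies $(s,\vec\phi,f^{+a})\models\phi$. Then the set of formulas $\phi$ that are valid on the class of initial asynchronous models, i.e. such that $(s,\epsilon,f_0)\models\phi$ for every epistemic model $(S,\sim,V)$ and every $s\in S$, is decidable. -/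

import Mathlib

universe u v w

namespace AsyncAnnouncement


/-- Formulas of asynchronous announcement logic over agents `A` and propositional variables `P`:
`know a φ` is `K_a φ`, `ann ψ φ` is `[ψ] φ`, and `next a φ` is `X_a φ`. -/
inductive Form (A : Type v) (P : Type w) : Type (max v w) where
  | atom : P → Form A P
  | neg : Form A P → Form A P
  | and : Form A P → Form A P → Form A P
  | know : A → Form A P → Form A P
  | ann : Form A P → Form A P → Form A P
  | next : A → Form A P → Form A P

/-- Epistemic (multi-agent S5) models. A state of the model, which witnesses that the domain is
non-empty, is always supplied separately as the actual state. -/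
structure EpistemicModel (A : Type v) (P : Type w) where
  State : Type u
  rel : A → State → State → Prop
  rel_equiv : ∀ a, Equivalence (rel a)
  val : P → Set State

variable {A : Type v} {P : Type w}

/-- `f^{+a}`: agent `a` receives one more announcement. -/
noncomputable def bump (f : A → ℕ) (a : A) : A → ℕ :=
  open Classical in Function.update f a (f a + 1)

/-- One reception event, when `n` announcements have been sent: some agent `a` with `f a < n`
receives its next announcement. -/
def Receive (n : ℕ) (f f' : A → ℕ) : Prop :=
  ∃ a, f a < n ∧ f' = bump f a

/-- The relation `g ≤_a f` between cuts: `g a = f a` and `g b ≤ f a` for all `b ≠ a`. -/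
def CutLe (a : A) (g f : A → ℕ) : Prop :=
  g a = f a ∧ ∀ b, b ≠ a → g b ≤ f a

-- Protocols are lists of announcements with the most recent announcement at the head, so that
-- `ψ :: h` is the protocol `h` followed by the announcement `ψ`. A cut is a function `A → ℕ`.
-- In `Good` the cut is bounded by the length of the protocol (see `IsAsyncModel.cut_le`).
mutual

/-- `(S, ∼, V, s, h, f)` is an asynchronous model. The predicate coincides with the inductively
defined `IsAsyncModel`, see `good_iff`. -/
def Good (M : EpistemicModel.{u, v, w} A P) (s : M.State) :
    List (Form A P) → (A → ℕ) → Prop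
  | [], f => f = fun _ => 0
  | φ :: h, f => ∃ g, Good M s h g ∧ Sat M s h g φ ∧
      Relation.ReflTransGen (Receive (h.length + 1)) g f
termination_by h _ => (sizeOf h, 0)
decreasing_by all_goals (simp_wf; simp only [Prod.lex_def]; omega)

/-- `(S, ∼, V, s, h, f) ⊨ φ`. -/
def Sat (M : EpistemicModel.{u, v, w} A P) (s : M.State)
    (h : List (Form A P)) (f : A → ℕ) : Form A P → Prop
  | .atom p => s ∈ M.val p
  | .neg φ => ¬ Sat M s h f φ
  | .and φ ψ => Sat M s h f φ ∧ Sat M s h f ψ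
  | .know a φ => ∀ (t : M.State) (g : A → ℕ),
      M.rel a t s → CutLe a g f → Good M t h g → Sat M t h g φ
  | .ann ψ φ => Sat M s h f ψ → Sat M s (ψ :: h) f φ
  | .next a φ => f a < h.length → Sat M s h (bump f a) φ
termination_by φ => (sizeOf h + sizeOf φ, sizeOf φ)
decreasing_by all_goals (simp_wf; simp only [Prod.lex_def]; omega)

end

/-- Asynchronous models by the usual inductive clauses: initial models, sending a true
announcement, and reception of an announcement by an agent. -/
inductive IsAsyncModel (M : EpistemicModel.{u, v, w} A P) (s : M.State) :
    List (Form A P) → (A → ℕ) → Prop where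
  | init : IsAsyncModel M s [] (fun _ => 0)
  | send {h : List (Form A P)} {f : A → ℕ} {φ : Form A P} :
      IsAsyncModel M s h f → Sat M s h f φ → IsAsyncModel M s (φ :: h) f
  | receive {h : List (Form A P)} {f : A → ℕ} {a : A} :
      IsAsyncModel M s h f → f a < h.length → IsAsyncModel M s h (bump f a)

theorem IsAsyncModel.cut_le {M : EpistemicModel.{u, v, w} A P} {s : M.State}
    {h : List (Form A P)} {f : A → ℕ} (H : IsAsyncModel M s h f) (b : A) : f b ≤ h.length := by
  induction H with
  | init => simp
  | send _ _ ih => exact ih.trans (by simp)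
  | @receive h f a _ hlt ih =>
    classical
    by_cases hb : b = a
    · subst hb; simpa [bump] using hlt
    · simpa [bump, Function.update_of_ne hb] using ih

theorem good_iff (M : EpistemicModel.{u, v, w} A P) (s : M.State)
    (h : List (Form A P)) (f : A → ℕ) : Good M s h f ↔ IsAsyncModel M s h f := by
  constructor
  · intro H
    induction h generalizing f with
    | nil =>
      rw [Good] at H
      subst H
      exact .init
    | cons φ h ih =>
      rw [Good] at H
      obtain ⟨g, hg, hs, hr⟩ := H
      induction hr with
      | refl => exact .send (ih g hg) hs
      | tail _ hstep ih' =>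
        obtain ⟨a, ha, rfl⟩ := hstep
        exact .receive ih' (by simpa using ha)
  · intro H
    induction H with
    | init => rw [Good]
    | @send h f φ _ hs ih =>
      rw [Good]
      exact ⟨f, ih, hs, .refl⟩
    | @receive h f a _ hlt ih =>
      cases h with
      | nil => simp at hlt
      | cons φ h =>
        rw [Good] at ih ⊢
        obtain ⟨g, hg, hs, hr⟩ := ih
        exact ⟨g, hg, hs, hr.tail ⟨a, by simpa using hlt, rfl⟩⟩

/-- The semantics of asynchronous knowledge. -/
theorem sat_know (M : EpistemicModel.{u, v, w} A P) (s : M.State)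
    (h : List (Form A P)) (f : A → ℕ) (a : A) (φ : Form A P) :
    Sat M s h f (.know a φ) ↔ ∀ (t : M.State) (g : A → ℕ),
      M.rel a t s → CutLe a g f → IsAsyncModel M t h g → Sat M t h g φ := by
  rw [Sat]
  simp only [good_iff]

/-- `⊨_ε φ`: `φ` is true in all initial asynchronous models, that is, at all states of all
epistemic models, with the empty protocol and the zero cut. -/
def ValidInit (φ : Form A P) : Prop :=
  ∀ (M : EpistemicModel.{u, v, w} A P) (s : M.State), Sat M s [] (fun _ => 0) φ

/-- The Gödel number of a formula. -/
def Form.code [Encodable A] [Encodable P] : Form A P → ℕ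
  | .atom p => Nat.pair 0 (Encodable.encode p)
  | .neg φ => Nat.pair 1 φ.code
  | .and φ ψ => Nat.pair 2 (Nat.pair φ.code ψ.code)
  | .know a φ => Nat.pair 3 (Nat.pair (Encodable.encode a) φ.code)
  | .ann φ ψ => Nat.pair 4 (Nat.pair φ.code ψ.code)
  | .next a φ => Nat.pair 5 (Nat.pair (Encodable.encode a) φ.code)

theorem Form.code_injective [Encodable A] [Encodable P] :
    Function.Injective (Form.code : Form A P → ℕ) := by
  intro φ
  induction φ with
  | atom p => intro χ; cases χ <;> simp [Form.code, Nat.pair_eq_pair]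
  | neg φ ih =>
    intro χ; cases χ <;> simp [Form.code, Nat.pair_eq_pair]
    exact fun h => ih h
  | and φ ψ ih₁ ih₂ =>
    intro χ; cases χ <;> simp [Form.code, Nat.pair_eq_pair]
    exact fun h₁ h₂ => ⟨ih₁ h₁, ih₂ h₂⟩
  | know a φ ih =>
    intro χ; cases χ <;> simp [Form.code, Nat.pair_eq_pair]
    exact fun h₁ h₂ => ⟨h₁, ih h₂⟩
  | ann φ ψ ih₁ ih₂ =>
    intro χ; cases χ <;> simp [Form.code, Nat.pair_eq_pair]
    exact fun h₁ h₂ => ⟨ih₁ h₁, ih₂ h₂⟩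
  | next a φ ih =>
    intro χ; cases χ <;> simp [Form.code, Nat.pair_eq_pair]
    exact fun h₁ h₂ => ⟨h₁, ih h₂⟩

end AsyncAnnouncement

/-!
Truth in asynchronous models is turned into a system of equations that speaks about single states of
an epistemic model. Its unknowns (`Node`) are the statements "`φ` is true after the protocol `h`
at the cut `f`", "`(h, f)` is not an asynchronous model" and "the atom `p` is true". By the
semantics, each of them is equivalent to a conjunctive normal form in other unknowns, boxed by one
agent in the case of `K_a φ` (`Node.solved`). The clauses are finite because there are finitely many
agents: `K_a` quantifies over cuts bounded by `f a`, and the cuts reachable from `g` by reception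
are those above `g` and bounded by the length of the protocol (`reflTransGen_receive_iff`). The
unknowns on the right-hand side have smaller measure (`Node.measure_lt`), so a formula depends on a
finite set `C` of unknowns, obtained by iterating the equations (`iterate_expand_closed`).

Such systems have the finite model property by filtration (`refutable_of_solved`). A state is
replaced by its type, the set of unknowns in `C` that are true there, and two types are related for
an agent when they agree on the unknowns boxed by this agent. Conversely, a finite family of types
that solves the equations is itself an epistemic model, and there truth of a node is membership, as
both solve the same well-founded system (`holds_typeModel_iff`). Hence a formula fails to be valid
if and only if some family of subsets of `C` solves the equations and omits the formula from a
member (`validInit_iff`). This is a search through a finite list, which requires no recursion on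
formulas or models, and it is primitive recursive in the Gödel number since the equations are
(`primrec_step`, `primrecPred_refutable`).
-/

namespace AsyncAnnouncement

/-! ### Systems of modal equations and filtration -/

/-- A propositional formula in conjunctive normal form over unknowns `β`; a literal `(v, b)` says
that the truth value of `b` is `v`. -/
abbrev Clauses (β : Type*) := List (List (Bool × β))

/-- Truth of a conjunctive normal form when the true unknowns are those satisfying `p`. -/
def Clauses.Holds {β : Type*} (p : β → Prop) (c : Clauses β) : Prop :=
  ∀ d ∈ c, ∃ x ∈ d, (p x.2 ↔ x.1 = true)

/-- The right-hand side of an equation for an unknown. The first component is `none` when the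
unknown is unconstrained, `some none` when it is equivalent to the given clauses, and
`some (some i)` when it is equivalent to "`i` knows the given clauses". -/
abbrev Equation (ι β : Type*) := Option (Option ι) × Clauses β

/-- The unknowns occurring in an equation. -/
def Equation.vars {ι β : Type*} (e : Equation ι β) : List β :=
  e.2.flatten.map Prod.snd

/-- In the Kripke frame `(X, R)` the valuation `H` of unknowns satisfies the equation `b = e`. -/
def Equation.Solved {ι β X : Type*} (R : ι → X → X → Prop) (H : X → β → Prop) (b : β) :
    Equation ι β → Prop
  | (none, _) => True
  | (some none, c) => ∀ x, H x b ↔ c.Holds (H x)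
  | (some (some i), c) => ∀ x, H x b ↔ ∀ y, R i y x → c.Holds (H y)

theorem Clauses.holds_congr {β : Type*} {p q : β → Prop} {c : Clauses β}
    (h : ∀ b ∈ c.flatten.map Prod.snd, (p b ↔ q b)) : c.Holds p ↔ c.Holds q := by
  have key : ∀ d ∈ c, ∀ x ∈ d, (p x.2 ↔ q x.2) := fun d hd x hx =>
    h _ (List.mem_map_of_mem (List.mem_flatten_of_mem hd hx))
  constructor
  · intro H d hd
    obtain ⟨x, hx, e⟩ := H d hd
    exact ⟨x, hx, (key d hd x hx).symm.trans e⟩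
  · intro H d hd
    obtain ⟨x, hx, e⟩ := H d hd
    exact ⟨x, hx, (key d hd x hx).trans e⟩

theorem Clauses.holds_map {β γ : Type*} (f : β → γ) (p : γ → Prop) (c : Clauses β) :
    Clauses.Holds p (c.map (List.map (Prod.map id f))) ↔ c.Holds (fun b => p (f b)) := by
  simp [Clauses.Holds]

theorem Equation.solved_map {ι β γ X : Type*} {R : ι → X → X → Prop} {f : β → γ}
    {H : X → γ → Prop} {b : β} {e : Equation ι β} :
    Equation.Solved R H (f b) (e.1, e.2.map (List.map (Prod.map id f))) ↔
      e.Solved R (fun x b => H x (f b)) b := by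
  rcases e with ⟨_ | _ | i, c⟩ <;> simp only [Equation.Solved, Clauses.holds_map]

section Types

variable {ι β : Type*} (step : β → Equation ι β)

/-- Two types (sets of true unknowns, given as lists) agree on the unknowns from `C` whose
equation has modality `k`. This is the accessibility relation between types. -/
def Agree (C : List β) (T T' : List β) (k : Option (Option ι)) : Prop :=
  ∀ b ∈ C, (step b).1 = k → (b ∈ T ↔ b ∈ T')

/-- The family `W` of types satisfies the equations of the unknowns from `C`, when types are
related by `Agree`. -/
def IsSolution (C : List β) (W : List (List β)) : Prop :=
  ∀ T ∈ W, ∀ b ∈ C, (step b).1 = none ∨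
    ((step b).1 = some none ∧ (b ∈ T ↔ (step b).2.Holds (· ∈ T))) ∨
    (((step b).1 ≠ none ∧ (step b).1 ≠ some none) ∧
      (b ∈ T ↔ ∀ T' ∈ W, Agree step C T' T (step b).1 → (step b).2.Holds (· ∈ T')))

/-- A finite family of types over `C` solves the equations and has a member in which `b` is
false. -/
def Refutable (C : List β) (b : β) : Prop :=
  ∃ W ∈ C.sublists'.sublists', IsSolution step C W ∧ ∃ T ∈ W, b ∉ T

variable {step}

theorem agree_equivalence (C : List β) (k : Option (Option ι)) :
    Equivalence (fun T T' => Agree step C T T' k) where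
  refl _ _ _ _ := Iff.rfl
  symm h b hb e := (h b hb e).symm
  trans h h' b hb e := (h b hb e).trans (h' b hb e)

/-- A solution over types solves the equations on the frame of its members. -/
theorem IsSolution.solved {C : List β} {W : List (List β)} (h : IsSolution step C W)
    {b : β} (hb : b ∈ C) :
    (step b).Solved (fun i (T T' : {T // T ∈ W}) => Agree step C T T' (some (some i)))
      (fun T b => b ∈ T.1) b := by
  have h' := fun T hT => h T hT b hb
  revert h'
  rcases step b with ⟨_ | _ | i, c⟩
  · exact fun _ => trivial
  · exact fun h' T => by simpa using h' T.1 T.2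
  · intro h' T
    simpa using h' T.1 T.2

/-- Filtration: a solution on an arbitrary frame of equivalence relations in which `b` is somewhere
false yields one by finitely many types, namely those realized in the frame. A realized type that
agrees with the type of `x` on the unknowns boxed by `i` makes the same boxed unknowns true, and
these imply their own clauses by reflexivity. -/
theorem refutable_of_solved {X : Type*} {R : ι → X → X → Prop} (hR : ∀ i, Equivalence (R i))
    {H : X → β → Prop} {C : List β} (hC : ∀ b ∈ C, ∀ b' ∈ (step b).vars, b' ∈ C)
    (hH : ∀ b ∈ C, (step b).Solved R H b) {b : β} (hb : b ∈ C) {x : X} (hx : ¬ H x b) :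
    Refutable step C b := by
  classical
  let ty : X → List β := fun x => C.filter (fun b => H x b)
  have mem_ty : ∀ x, ∀ b ∈ C, (b ∈ ty x ↔ H x b) := fun x b hb => by simp [ty, hb]
  refine ⟨C.sublists'.filter (fun T => ∃ x, T = ty x), ?_, ?_, ty x, ?_, ?_⟩
  · exact List.mem_sublists'.2 List.filter_sublist
  · intro T hT b hb
    obtain ⟨x, rfl⟩ : ∃ x, T = ty x := by simpa using (List.mem_filter.1 hT).2
    have hs := hH b hb
    have hc : ∀ y, (step b).2.Holds (· ∈ ty y) ↔ (step b).2.Holds (H y) := fun y =>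
      Clauses.holds_congr fun b' hb' => mem_ty y b' (hC b hb b' hb')
    rcases hk : step b with ⟨_ | _ | i, c⟩
    · exact Or.inl rfl
    · rw [hk] at hs hc
      exact Or.inr (Or.inl ⟨rfl, by rw [mem_ty x b hb, hc]; exact hs x⟩)
    · rw [hk] at hs hc
      refine Or.inr (Or.inr ⟨⟨by simp, by simp⟩, ?_⟩)
      rw [mem_ty x b hb]
      constructor
      · intro hxb T' hT' hag
        obtain ⟨y, rfl⟩ : ∃ x, T' = ty x := by simpa using (List.mem_filter.1 hT').2
        have : b ∈ ty y := (hag b hb (by rw [hk])).2 ((mem_ty x b hb).2 hxb)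
        exact (hc y).2 ((hs y).1 ((mem_ty y b hb).1 this) y ((hR i).refl y))
      · intro hall
        refine (hs x).2 fun y hy => (hc y).1 (hall (ty y) ?_ ?_)
        · simpa [ty] using ⟨y, rfl⟩
        · intro b' hb' hk'
          rw [mem_ty y b' hb', mem_ty x b' hb']
          have hs' := hH b' hb'
          rcases he : step b' with ⟨k', c'⟩
          rw [he] at hk' hs'
          obtain rfl : k' = some (some i) := hk'
          rw [hs' y, hs' x]
          exact ⟨fun h z hz => h z ((hR i).trans hz ((hR i).symm hy)),
            fun h z hz => h z ((hR i).trans hz hy)⟩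
  · simpa [ty] using ⟨x, rfl⟩
  · rwa [mem_ty x b hb]

/-- One round of adding to a list of unknowns all unknowns occurring in their equations. -/
def expand (step : β → Equation ι β) (L : List β) : List β :=
  L.flatMap fun b => b :: (step b).vars

theorem mem_expand {L : List β} {b : β} :
    b ∈ expand step L ↔ b ∈ L ∨ ∃ b' ∈ L, b ∈ (step b').vars := by
  simp only [expand, List.mem_flatMap, List.mem_cons]
  constructor
  · rintro ⟨a, ha, rfl | h⟩
    · exact Or.inl ha
    · exact Or.inr ⟨a, ha, h⟩
  · rintro (h | ⟨a, ha, h⟩)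
    · exact ⟨b, h, Or.inl rfl⟩
    · exact ⟨a, ha, Or.inr h⟩

theorem mem_iterate_expand_self (b : β) (n : ℕ) : b ∈ (expand step)^[n] [b] := by
  induction n with
  | zero => simp
  | succ n ih =>
    rw [Function.iterate_succ_apply', mem_expand]
    exact Or.inl ih

/-- If the unknowns satisfying an invariant `good` have equations in unknowns of smaller measure
satisfying `good`, then expansion becomes stationary once it has been iterated more often than
the measure of the initial unknown. -/
theorem iterate_expand_closed {good : β → Prop} {μ : β → ℕ}
    (hstep : ∀ b, good b → ∀ b' ∈ (step b).vars, good b' ∧ μ b' < μ b)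
    {b₀ : β} (h₀ : good b₀) {n : ℕ} (hn : μ b₀ < n) :
    ∀ b ∈ (expand step)^[n] [b₀],
      good b ∧ ∀ b' ∈ (step b).vars, b' ∈ (expand step)^[n] [b₀] := by
  -- after `n` rounds, an unknown that is not yet expanded was reached by a descent of `n` steps
  have key : ∀ n, ∀ b ∈ (expand step)^[n] [b₀], good b ∧
      (μ b + n ≤ μ b₀ ∨ ∀ b' ∈ (step b).vars, b' ∈ (expand step)^[n] [b₀]) := by
    intro n
    induction n with
    | zero => simp [h₀]
    | succ n ih =>
      intro b hb
      rw [Function.iterate_succ_apply'] at hb ⊢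
      have old : b ∈ (expand step)^[n] [b₀] → good b ∧ (μ b + (n + 1) ≤ μ b₀ ∨
          ∀ b' ∈ (step b).vars, b' ∈ expand step ((expand step)^[n] [b₀])) := fun h =>
        ⟨(ih b h).1, Or.inr fun b' hb' => mem_expand.2 (Or.inr ⟨b, h, hb'⟩)⟩
      rcases mem_expand.1 hb with h | ⟨a, ha, hba⟩
      · exact old h
      · obtain ⟨ga, h | h⟩ := ih a ha
        · have := hstep a ga b hba
          exact ⟨this.1, Or.inl (by omega)⟩
        · exact old (h b hba)
  intro b hb
  obtain ⟨h, h' | h'⟩ := key n b hb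
  · omega
  · exact ⟨h, h'⟩

end Types

/-! ### Primitive recursiveness of the search for a solution -/

section Primrec

open Primrec

variable {α β ι : Type*} [Primcodable α] [Primcodable β] [Primcodable ι]

theorem primrecPred_forall_mem {L : α → List β} {R : α → β → Prop} (hL : Primrec L)
    (hR : PrimrecPred fun p : α × β => R p.1 p.2) : PrimrecPred fun a => ∀ b ∈ L a, R a b :=
  hR.primrecRel.swap.forall_mem_list.comp hL Primrec.id

theorem primrecPred_exists_mem {L : α → List β} {R : α → β → Prop} (hL : Primrec L)
    (hR : PrimrecPred fun p : α × β => R p.1 p.2) : PrimrecPred fun a => ∃ b ∈ L a, R a b :=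
  hR.primrecRel.swap.exists_mem_list.comp hL Primrec.id

theorem primrecPred_mem {f : α → β} {L : α → List β} (hf : Primrec f) (hL : Primrec L) :
    PrimrecPred fun a => f a ∈ L a :=
  (primrecPred_exists_mem hL (R := fun a b => b = f a)
    (Primrec.eq.comp Primrec.snd (hf.comp Primrec.fst))).of_eq fun a => by simp

theorem primrecPred_imp {p q : α → Prop} (hp : PrimrecPred p) (hq : PrimrecPred q) :
    PrimrecPred fun a => p a → q a :=
  (hp.not.or hq).of_eq fun _ => imp_iff_not_or.symm

theorem primrecPred_iff {p q : α → Prop} (hp : PrimrecPred p) (hq : PrimrecPred q) :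
    PrimrecPred fun a => p a ↔ q a :=
  ((primrecPred_imp hp hq).and (primrecPred_imp hq hp)).of_eq fun _ => iff_def.symm

theorem primrec_sublists' : Primrec (List.sublists' : List β → List (List β)) := by
  have : Primrec fun L : List β =>
      L.foldr (fun b S => S ++ S.map (List.cons b)) ([[]] : List (List β)) := by
    refine list_foldr
      (h := fun (_ : List β) (p : β × List (List β)) => p.2 ++ p.2.map (List.cons p.1)) Primrec.id
      (const _) ?_
    exact list_append.comp (snd.comp snd) (list_map (snd.comp snd)
      (list_cons.comp (fst.comp (snd.comp fst)) snd))
  refine this.of_eq fun L => ?_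
  induction L with
  | nil => rfl
  | cons b L ih => rw [List.foldr_cons, ih, List.sublists'_cons]

theorem primrecPred_holds {c : α → Clauses β} {T : α → List β} (hc : Primrec c) (hT : Primrec T) :
    PrimrecPred fun a => (c a).Holds (· ∈ T a) := by
  refine primrecPred_forall_mem hc ?_
  refine primrecPred_exists_mem snd ?_
  exact primrecPred_iff (primrecPred_mem (snd.comp snd) (hT.comp (fst.comp fst)))
    (Primrec.eq.comp (fst.comp snd) (const true))

theorem primrecPred_agree {step : β → Equation ι β} (hs : Primrec step) {C T T' : α → List β}
    {k : α → Option (Option ι)} (hC : Primrec C) (hT : Primrec T) (hT' : Primrec T')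
    (hk : Primrec k) : PrimrecPred fun a => Agree step (C a) (T a) (T' a) (k a) := by
  refine primrecPred_forall_mem hC ?_
  exact primrecPred_imp (Primrec.eq.comp (fst.comp (hs.comp snd)) (hk.comp fst))
    (primrecPred_iff (primrecPred_mem snd (hT.comp fst)) (primrecPred_mem snd (hT'.comp fst)))

theorem primrecPred_isSolution {step : β → Equation ι β} (hs : Primrec step)
    {C : α → List β} {W : α → List (List β)} (hC : Primrec C) (hW : Primrec W) :
    PrimrecPred fun a => IsSolution step (C a) (W a) := by
  refine primrecPred_forall_mem hW ?_
  refine primrecPred_forall_mem (hC.comp fst) ?_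
  have hk : Primrec fun p : (α × List β) × β => (step p.2).1 := fst.comp (hs.comp snd)
  have hc : Primrec fun p : (α × List β) × β => (step p.2).2 := snd.comp (hs.comp snd)
  have hmem : PrimrecPred fun p : (α × List β) × β => p.2 ∈ p.1.2 :=
    primrecPred_mem snd (snd.comp fst)
  refine (Primrec.eq.comp hk (const none)).or (.or ?_ ?_)
  · exact (Primrec.eq.comp hk (const _)).and
      (primrecPred_iff hmem (primrecPred_holds hc (snd.comp fst)))
  · refine .and (.and (Primrec.eq.comp hk (const _)).not (Primrec.eq.comp hk (const _)).not) ?_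
    refine primrecPred_iff hmem ?_
    refine primrecPred_forall_mem (hW.comp (fst.comp fst)) ?_
    exact primrecPred_imp
      (primrecPred_agree hs (hC.comp (fst.comp (fst.comp fst))) snd (snd.comp (fst.comp fst))
        (hk.comp fst))
      (primrecPred_holds (hc.comp fst) snd)

theorem primrecPred_refutable {step : β → Equation ι β} (hs : Primrec step)
    {C : α → List β} {b : α → β} (hC : Primrec C) (hb : Primrec b) :
    PrimrecPred fun a => Refutable step (C a) (b a) := by
  refine primrecPred_exists_mem (primrec_sublists'.comp (primrec_sublists'.comp hC))
    ?_
  refine (primrecPred_isSolution hs (hC.comp fst) snd).and ?_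
  refine primrecPred_exists_mem snd ?_
  exact (primrecPred_mem (hb.comp (fst.comp fst)) snd).not

theorem primrec_expand {step : β → Equation ι β} (hs : Primrec step) :
    Primrec (expand step) := by
  refine list_flatMap (g := fun _ b => b :: (step b).vars) Primrec.id (list_cons.comp snd ?_)
  exact list_map (list_flatten.comp (snd.comp (hs.comp snd))) (snd.comp snd)

end Primrec

/-! ### Cuts indexed by an initial segment -/

/-- All cuts with values at most `n`. -/
def cuts : (k : ℕ) → ℕ → List (Fin k → ℕ)
  | 0, _ => [fun _ => 0]
  | k + 1, n => (List.range (n + 1)).flatMap fun x => (cuts k n).map fun g => Fin.cons x g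

theorem mem_cuts {k n : ℕ} {g : Fin k → ℕ} : g ∈ cuts k n ↔ ∀ i, g i ≤ n := by
  induction k with
  | zero => simpa [cuts] using Subsingleton.elim _ _
  | succ k ih =>
    simp only [cuts, List.mem_flatMap, List.mem_range, List.mem_map, Fin.forall_fin_succ]
    constructor
    · rintro ⟨x, hx, g, hg, rfl⟩
      exact ⟨by simpa using Nat.lt_succ_iff.1 hx, by simpa using ih.1 hg⟩
    · rintro ⟨h₀, h⟩
      exact ⟨g 0, Nat.lt_succ_iff.2 h₀, Fin.tail g, ih.2 h, Fin.cons_self_tail g⟩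

/-- `bump` for cuts indexed by `Fin k`. -/
def bumpFin {k : ℕ} (f : Fin k → ℕ) (i : Fin k) : Fin k → ℕ :=
  fun j => if j = i then f j + 1 else f j

section Nodes

variable {A : Type v} {P : Type w} {k : ℕ}

/-! ### The nodes of the unfolding of a formula and their equations -/

/-- A statement about a state of an epistemic model, with agents numbered by `Fin k`. -/
inductive Node (A : Type v) (P : Type w) (k : ℕ) : Type (max v w)
  /-- The atom `p` is true. -/
  | atom : P → Node A P k
  /-- The formula is true after the given protocol, at the given cut. -/
  | sat : List (Form A P) → (Fin k → ℕ) → Form A P → Node A P k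
  /-- The given protocol and cut do not form an asynchronous model. -/
  | bad : List (Form A P) → (Fin k → ℕ) → Node A P k

/-- Truth of a node at a state. -/
def Node.Holds (e : A ≃ Fin k) (M : EpistemicModel.{u, v, w} A P) (s : M.State) :
    Node A P k → Prop
  | .atom p => s ∈ M.val p
  | .sat h f φ => Sat M s h (fun a => f (e a)) φ
  | .bad h f => ¬ Good M s h (fun a => f (e a))

/-- The clauses, boxed by the agent `i`, that are equivalent to a formula `K_i φ` at the cut `f`.
Here `bad g` and `sat g` are the unknowns saying that the cut `g` is impossible, and that `φ`
is true at `g`. -/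
def knowClauses {β : Type*} (bad sat : (Fin k → ℕ) → β) (f : Fin k → ℕ) (i : Fin k) : Clauses β :=
  ((cuts k (f i)).filter fun g => g i = f i).map fun g => [(true, bad g), (true, sat g)]

/-- The clauses saying that `f` is not a cut of the asynchronous models after announcing `φ` to a
protocol of length `n`: no cut `g` below `f` at which `φ` could be announced. The unknown `bad g`
says that the cut `g` is impossible before the announcement, and `sat g` that `φ` is true at `g`. -/
def badClauses {β : Type*} (bad sat : (Fin k → ℕ) → β) (n : ℕ) (f : Fin k → ℕ) : Clauses β :=
  ((cuts k n).filter fun g => ∀ i, g i ≤ f i ∧ f i ≤ n + 1).map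
    fun g => [(true, bad g), (false, sat g)]

theorem holds_knowClauses {β : Type*} {bad sat : (Fin k → ℕ) → β} {f : Fin k → ℕ} {i : Fin k}
    {p : β → Prop} : (knowClauses bad sat f i).Holds p ↔
      ∀ g, g ∈ cuts k (f i) ∧ g i = f i → p (bad g) ∨ p (sat g) := by
  simp only [Clauses.Holds, knowClauses, List.forall_mem_map, List.mem_filter,
    decide_eq_true_eq, List.mem_cons, List.not_mem_nil, or_false, exists_eq_or_imp,
    exists_eq_left, iff_true]

theorem holds_badClauses {β : Type*} {bad sat : (Fin k → ℕ) → β} {n : ℕ} {f : Fin k → ℕ}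
    {p : β → Prop} : (badClauses bad sat n f).Holds p ↔
      ∀ g, (∀ i, g i ≤ n) ∧ (∀ i, g i ≤ f i ∧ f i ≤ n + 1) → p (bad g) ∨ ¬ p (sat g) := by
  simp only [Clauses.Holds, badClauses, List.forall_mem_map, List.mem_filter, mem_cuts,
    decide_eq_true_eq, List.mem_cons, List.not_mem_nil, or_false, exists_eq_or_imp,
    exists_eq_left, iff_true, Bool.false_eq_true, iff_false]

/-- The equation of a node: its truth condition in terms of smaller nodes. -/
def Node.eqn (e : A ≃ Fin k) : Node A P k → Equation (Fin k) (Node A P k)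
  | .atom _ => (none, [])
  | .sat _ _ (.atom p) => (some none, [[(true, .atom p)]])
  | .sat h f (.neg φ) => (some none, [[(false, .sat h f φ)]])
  | .sat h f (.and φ ψ) => (some none, [[(true, .sat h f φ)], [(true, .sat h f ψ)]])
  | .sat h f (.know a φ) =>
      (some (some (e a)), knowClauses (.bad h) (fun g => .sat h g φ) f (e a))
  | .sat h f (.ann ψ φ) => (some none, [[(false, .sat h f ψ), (true, .sat (ψ :: h) f φ)]])
  | .sat h f (.next a φ) =>
      (some none, if f (e a) < h.length then [[(true, .sat h (bumpFin f (e a)) φ)]] else [])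
  | .bad [] f => (some none, if ∀ i, f i = 0 then [[]] else [])
  | .bad (φ :: h) f => (some none, badClauses (.bad h) (fun g => .sat h g φ) h.length f)

/-- The number of symbols of a formula. -/
def Form.weight : Form A P → ℕ
  | .atom _ => 1
  | .neg φ => φ.weight + 1
  | .and φ ψ => φ.weight + ψ.weight + 1
  | .know _ φ => φ.weight + 1
  | .ann ψ φ => ψ.weight + φ.weight + 1
  | .next _ φ => φ.weight + 1

theorem Form.weight_pos (φ : Form A P) : 0 < φ.weight := by
  cases φ <;> simp [Form.weight]

/-- The measure that decreases along equations. -/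
def Node.measure : Node A P k → ℕ
  | .atom _ => 0
  | .sat h _ φ => 2 * ((h.map Form.weight).sum + φ.weight)
  | .bad h _ => 2 * (h.map Form.weight).sum + 1

theorem Node.measure_lt (e : A ≃ Fin k) (n : Node A P k) :
    ∀ n' ∈ (n.eqn e).vars, n'.measure < n.measure := by
  rcases n with p | ⟨h, f, φ⟩ | ⟨h, f⟩
  · simp [Node.eqn, Equation.vars]
  · have hφ := φ.weight_pos
    cases φ with
    | next a φ =>
      simp only [Node.eqn, Equation.vars]
      split_ifs <;> simp [Node.measure, Form.weight]
    | and φ ψ => simp [Node.eqn, Equation.vars, Node.measure, Form.weight]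
    | ann φ ψ => simp [Node.eqn, Equation.vars, Node.measure, Form.weight]; omega
    | know a φ =>
      simp [Node.eqn, Equation.vars, knowClauses]
      rintro n g hg hg' (rfl | rfl) <;>
        simp [Node.measure, Form.weight]
      omega
    | _ => simp [Node.eqn, Equation.vars, Node.measure, Form.weight]
  · cases h with
    | nil =>
      simp only [Node.eqn, Equation.vars]
      split_ifs <;> simp
    | cons φ h =>
      have hφ := φ.weight_pos
      simp [Node.eqn, Equation.vars, badClauses]
      rintro n g hg hg' (rfl | rfl) <;>
        simp [Node.measure] <;> omega

/-! ### Correctness of the equations -/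

theorem cutLe_iff {e : A ≃ Fin k} {a : A} {g f : Fin k → ℕ} :
    CutLe a (fun b => g (e b)) (fun b => f (e b)) ↔ g ∈ cuts k (f (e a)) ∧ g (e a) = f (e a) := by
  rw [mem_cuts]
  constructor
  · rintro ⟨h₁, h₂⟩
    refine ⟨fun i => ?_, h₁⟩
    by_cases hi : e.symm i = a
    · subst hi
      simpa using h₁.le
    · simpa using h₂ _ hi
  · exact fun ⟨h₁, h₂⟩ => ⟨h₂, fun b _ => h₁ (e b)⟩

theorem bump_comp (e : A ≃ Fin k) (f : Fin k → ℕ) (a : A) :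
    bump (fun b => f (e b)) a = fun b => bumpFin f (e a) (e b) := by
  classical
  funext b
  by_cases hb : b = a
  · subst hb
    simp [bump, bumpFin]
  · simp [bump, bumpFin, hb]

/-- Reception events lead from `g` to exactly the larger cuts. -/
theorem reflTransGen_receive_iff [Finite A] {n : ℕ} {g f : A → ℕ} (hg : ∀ a, g a ≤ n) :
    Relation.ReflTransGen (Receive n) g f ↔ ∀ a, g a ≤ f a ∧ f a ≤ n := by
  classical
  constructor
  · intro h
    induction h with
    | refl => exact fun a => ⟨le_rfl, hg a⟩
    | tail _ hstep ih =>
      obtain ⟨a, ha, rfl⟩ := hstep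
      intro b
      by_cases hb : b = a
      · subst hb
        simpa [bump] using ⟨(ih b).1.trans (Nat.le_succ _), ha⟩
      · simpa [bump, hb] using ih b
  · cases nonempty_fintype A
    -- induction on the number of receptions that are missing
    induction hm : ∑ a, (f a - g a) generalizing g with
    | zero =>
      intro h
      have : g = f := by
        funext a
        have := (Finset.sum_eq_zero_iff.1 hm) a (Finset.mem_univ a)
        have := h a
        omega
      rw [this]
    | succ m ih =>
      intro h
      obtain ⟨a, -, ha⟩ : ∃ a ∈ Finset.univ, f a - g a ≠ 0 := by
        by_contra! hcon
        rw [Finset.sum_eq_zero hcon] at hm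
        omega
      have hfa := h a
      have key : ∀ b, bump g a b = g b + if b = a then 1 else 0 := by
        intro b
        by_cases hb : b = a
        · subst hb
          simp [bump]
        · simp [bump, hb]
      refine Relation.ReflTransGen.head ⟨a, by omega, rfl⟩ (ih (g := bump g a) ?_ ?_ ?_)
      · intro b
        rw [key]
        have := hg b
        split_ifs with hb
        · subst hb; omega
        · omega
      · have : ∑ b, (f b - g b) = ∑ b, ((f b - bump g a b) + if b = a then 1 else 0) := by
          refine Finset.sum_congr rfl fun b _ => ?_
          rw [key]
          split_ifs with hb
          · subst hb; omega
          · omega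
        rw [Finset.sum_add_distrib, Finset.sum_ite_eq' Finset.univ a] at this
        simp at this
        omega
      · intro b
        rw [key]
        have := h b
        split_ifs with hb
        · subst hb; omega
        · omega

theorem forall_cut_iff (e : A ≃ Fin k) {p : (A → ℕ) → Prop} :
    (∀ g, p g) ↔ ∀ g : Fin k → ℕ, p (fun a => g (e a)) :=
  ⟨fun h g => h _, fun h g => by simpa using h (fun i => g (e.symm i))⟩

theorem Node.holds_bad_cons (e : A ≃ Fin k) (M : EpistemicModel.{u, v, w} A P) (s : M.State)
    (φ : Form A P) (h : List (Form A P)) (f : Fin k → ℕ) :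
    (Node.bad (φ :: h) f).Holds e M s ↔
      (badClauses (.bad h) (fun g => .sat h g φ) h.length f).Holds (Node.Holds e M s) := by
  have : Finite A := Finite.of_equiv _ e.symm
  have cut_le : ∀ {g : Fin k → ℕ}, Good M s h (fun a => g (e a)) → ∀ i, g i ≤ h.length :=
    fun {g} hg i => by simpa using ((good_iff M s h _).1 hg).cut_le (e.symm i)
  have rec_iff : ∀ {g : Fin k → ℕ}, Good M s h (fun a => g (e a)) →
      (Relation.ReflTransGen (Receive (h.length + 1)) (fun a => g (e a)) (fun a => f (e a)) ↔
        ∀ i, g i ≤ f i ∧ f i ≤ h.length + 1) := fun {g} hg => by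
    rw [reflTransGen_receive_iff fun a => (cut_le hg (e a)).trans (Nat.le_succ _)]
    exact e.forall_congr_left.trans (by simp)
  rw [holds_badClauses]
  simp only [Node.Holds, Good, not_exists, forall_cut_iff e]
  refine forall_congr' fun g => ?_
  by_cases hgood : Good M s h (fun a => g (e a))
  · have := cut_le hgood
    simp only [hgood, rec_iff hgood, true_and, not_true_eq_false, false_or]
    tauto
  · simp [hgood]

/-- In every epistemic model, truth of nodes satisfies the equations. -/
theorem Node.solved (e : A ≃ Fin k) (M : EpistemicModel.{u, v, w} A P) (n : Node A P k) :
    (n.eqn e).Solved (fun i => M.rel (e.symm i)) (Node.Holds e M) n := by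
  rcases n with p | ⟨h, f, φ⟩ | ⟨h, f⟩
  · exact trivial
  · cases φ with
    | know a φ =>
      intro s
      simp only [holds_knowClauses, Node.Holds, Sat, Equiv.symm_apply_apply]
      refine forall_congr' fun t => ?_
      rw [forall_cut_iff e]
      simp only [cutLe_iff, ← imp_iff_not_or]
      exact ⟨fun H hst g => H g hst, fun H g hst => H hst g⟩
    | next a φ =>
      intro s
      simp only [Node.Holds, Sat]
      split_ifs with hlt
      · simp [Clauses.Holds, Node.Holds, hlt, bump_comp]
      · simp [Clauses.Holds, hlt]
    | ann ψ φ =>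
      intro s
      simp only [Clauses.Holds, List.mem_singleton, forall_eq]
      simp [Node.Holds, Sat, imp_iff_not_or]
    | _ =>
      intro s
      simp [Node.Holds, Sat, Clauses.Holds]
  · cases h with
    | nil =>
      intro s
      have : ((fun a => f (e a)) = fun _ => 0) ↔ ∀ i, f i = 0 := by
        rw [funext_iff]
        exact e.forall_congr_left.trans (by simp)
      simp only [Node.Holds, Good, this]
      split_ifs with h0
      · simpa [Clauses.Holds] using h0
      · simpa [Clauses.Holds] using h0
    | cons φ h => exact fun s => Node.holds_bad_cons e M s φ h f

end Nodes

/-! ### The equations on Gödel numbers -/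

/-- Codes of nodes: a tag (`0` for atoms, `1` for formulas, `2` for impossible cuts), the Gödel
numbers of the announcements, the cut, and the Gödel number of the formula or atom. -/
abbrev NodeCode (k : ℕ) := ℕ × List ℕ × (Fin k → ℕ) × ℕ

section Encoding

variable {A : Type v} {P : Type w} [Encodable A] {k : ℕ}

/-- The code of a node. -/
def Node.enc [Encodable P] : Node A P k → NodeCode k
  | .atom p => (0, [], fun _ => 0, Encodable.encode p)
  | .sat h f φ => (1, h.map Form.code, f, φ.code)
  | .bad h f => (2, h.map Form.code, f, 0)

theorem Node.enc_injective [Encodable P] : Function.Injective (Node.enc : Node A P k → _) := by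
  have := Form.code_injective (A := A) (P := P)
  rintro (p | ⟨h, f, φ⟩ | ⟨h, f⟩) (p' | ⟨h', f', φ'⟩ | ⟨h', f'⟩) <;>
    simp [Node.enc, this.eq_iff, this.list_map.eq_iff]

/-- The number of the agent with code `c`, if there is one. It is read off from the finite list of
agents, because the decoding function of an encodable type need not be computable. -/
def agentIdx (e : A ≃ Fin k) (c : ℕ) : Option (Fin k) :=
  (List.finRange k)[((List.finRange k).map fun i => Encodable.encode (e.symm i)).idxOf c]?

theorem agentIdx_encode (e : A ≃ Fin k) (a : A) :
    agentIdx e (Encodable.encode a) = some (e a) := by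
  have hinj : Function.Injective fun i => Encodable.encode (e.symm i) :=
    Encodable.encode_injective.comp e.symm.injective
  have hmem : Encodable.encode a ∈
      (List.finRange k).map fun i => Encodable.encode (e.symm i) :=
    List.mem_map.2 ⟨e a, List.mem_finRange _, by simp⟩
  have h := List.getElem?_idxOf hmem
  rw [List.getElem?_map] at h
  obtain ⟨i, hi, hi'⟩ := Option.map_eq_some_iff.1 h
  rw [agentIdx, hi, Option.some_inj, ← e.symm.injective.eq_iff]
  simpa using hi'

/-- The equation of a formula, computed from codes: `h` is the protocol, `f` the cut, and the
formula has outermost symbol `t` and remaining code `r`. -/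
def stepSat (e : A ≃ Fin k) (h : List ℕ) (f : Fin k → ℕ) (t r : ℕ) :
    Equation (Fin k) (NodeCode k) :=
  if t = 0 then (some none, [[(true, (0, [], fun _ => 0, r))]])
  else if t = 1 then (some none, [[(false, (1, h, f, r))]])
  else if t = 2 then
    (some none, [[(true, (1, h, f, r.unpair.1))], [(true, (1, h, f, r.unpair.2))]])
  else if t = 3 then
    (agentIdx e r.unpair.1).elim (none, []) fun i =>
      (some (some i), knowClauses (fun g => (2, h, g, 0)) (fun g => (1, h, g, r.unpair.2)) f i)
  else if t = 4 then
    (some none, [[(false, (1, h, f, r.unpair.1)), (true, (1, r.unpair.1 :: h, f, r.unpair.2))]])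
  else
    (agentIdx e r.unpair.1).elim (none, []) fun i =>
      (some none, if f i < h.length then [[(true, (1, h, bumpFin f i, r.unpair.2))]] else [])

/-- The clauses of an impossible cut, computed from codes. -/
def stepBad (h : List ℕ) (f : Fin k → ℕ) : Clauses (NodeCode k) :=
  h.casesOn (if ∀ i, f i = 0 then [[]] else []) fun c h =>
    badClauses (fun g => (2, h, g, 0)) (fun g => (1, h, g, c)) h.length f

/-- The equation of a node, computed from its code. Values on numbers that code no node are
irrelevant. -/
def step (e : A ≃ Fin k) (b : NodeCode k) : Equation (Fin k) (NodeCode k) :=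
  if b.1 = 0 then (none, [])
  else if b.1 = 1 then stepSat e b.2.1 b.2.2.1 b.2.2.2.unpair.1 b.2.2.2.unpair.2
  else (some none, stepBad b.2.1 b.2.2.1)

theorem step_enc [Encodable P] (e : A ≃ Fin k) (n : Node A P k) :
    step e n.enc = ((n.eqn e).1, (n.eqn e).2.map (List.map (Prod.map id Node.enc))) := by
  rcases n with p | ⟨h, f, φ⟩ | ⟨h, f⟩
  · simp [step, Node.enc, Node.eqn]
  · cases φ with
    | next a φ =>
      simp only [step, Node.enc, Form.code, stepSat, Nat.unpair_pair, agentIdx_encode, Node.eqn]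
      by_cases hlt : f (e a) < h.length <;> simp [hlt, Node.enc]
    | know a φ =>
      simp [step, Node.enc, Form.code, stepSat, Node.eqn, agentIdx_encode, knowClauses,
        Function.comp_def]
      rfl
    | _ => simp [step, Node.enc, Form.code, stepSat, Node.eqn]
  · cases h with
    | nil =>
      simp only [step, Node.enc, stepBad, Node.eqn, List.map_nil]
      by_cases h0 : ∀ i, f i = 0 <;> simp [h0]
    | cons φ h => simp [step, Node.enc, stepBad, Node.eqn, badClauses, Function.comp_def]

theorem vars_step_enc [Encodable P] (e : A ≃ Fin k) (n : Node A P k) :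
    (step e n.enc).vars = (n.eqn e).vars.map Node.enc := by
  rw [step_enc]
  simp [Equation.vars, List.map_flatten, Function.comp_def]

/-! ### Primitive recursiveness of the equations -/

open Primrec

theorem primrec_cuts (k : ℕ) : Primrec (cuts k) := by
  induction k with
  | zero => exact const _
  | succ k ih =>
    have hcons : Primrec₂ fun (x : ℕ) (g : Fin k → ℕ) => (Fin.cons x g : Fin (k + 1) → ℕ) := by
      refine (vector_get'.comp (vector_cons.comp fst (vector_ofFn'.comp snd))).of_eq fun p => ?_
      funext i
      refine Fin.cases ?_ (fun i => ?_) i <;> simp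
    refine list_flatMap (g := fun n x => (cuts k n).map fun g => (Fin.cons x g : Fin (k + 1) → ℕ))
      (list_range.comp succ) ?_
    exact list_map (ih.comp fst) (hcons.comp (snd.comp fst) snd)

theorem primrec_agentIdx (e : A ≃ Fin k) : Primrec (agentIdx e) :=
  list_getElem?.comp (const _) (list_idxOf₁ _)

theorem primrecPred_forall_fin {α : Type*} [Primcodable α] {R : α → Fin k → Prop}
    (hR : PrimrecPred fun p : α × Fin k => R p.1 p.2) : PrimrecPred fun a => ∀ i, R a i :=
  (primrecPred_forall_mem (const (List.finRange k)) hR).of_eq fun a => by simp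

section

variable {α : Type*} [Primcodable α]

theorem primrec_cut_app {f : α → Fin k → ℕ} {i : α → Fin k} (hf : Primrec f) (hi : Primrec i) :
    Primrec fun a => f a (i a) :=
  fin_app.comp hf hi

theorem primrec_node {h : α → List ℕ} {f : α → Fin k → ℕ} {c : α → ℕ} (t : ℕ)
    (hh : Primrec h) (hf : Primrec f) (hc : Primrec c) :
    Primrec fun a => ((t, h a, f a, c a) : NodeCode k) :=
  Primrec.pair (const t) (Primrec.pair hh (Primrec.pair hf hc))

theorem primrec_singleton {β : Type*} [Primcodable β] {f : α → β} (hf : Primrec f) :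
    Primrec fun a => [f a] :=
  list_cons.comp hf (const [])

theorem primrec_bumpFin {f : α → Fin k → ℕ} {i : α → Fin k} (hf : Primrec f) (hi : Primrec i) :
    Primrec fun a => bumpFin (f a) (i a) := by
  refine fin_curry.2 ?_
  have happ : Primrec fun p : α × Fin k => f p.1 p.2 := primrec_cut_app (hf.comp fst) snd
  exact Primrec.ite (Primrec.eq.comp snd (hi.comp fst)) (succ.comp happ) happ

theorem primrec_knowClauses {β : Type*} [Primcodable β] {bad sat : α → (Fin k → ℕ) → β}
    {f : α → Fin k → ℕ} {i : α → Fin k} (hbad : Primrec₂ bad) (hsat : Primrec₂ sat)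
    (hf : Primrec f) (hi : Primrec i) :
    Primrec fun a => knowClauses (bad a) (sat a) (f a) (i a) := by
  have hfi := primrec_cut_app hf hi
  have hfilter : PrimrecRel fun (g : Fin k → ℕ) (a : α) => g (i a) = f a (i a) :=
    Primrec.eq.comp (primrec_cut_app fst (hi.comp snd)) (hfi.comp snd)
  refine list_map (g := fun a g => [(true, bad a g), (true, sat a g)])
    (hfilter.listFilter.comp ((primrec_cuts k).comp hfi) Primrec.id) ?_
  exact list_cons.comp (Primrec.pair (const _) hbad)
    (primrec_singleton (Primrec.pair (const _) hsat))

theorem primrec_badClauses {β : Type*} [Primcodable β] {bad sat : α → (Fin k → ℕ) → β}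
    {n : α → ℕ} {f : α → Fin k → ℕ} (hbad : Primrec₂ bad) (hsat : Primrec₂ sat)
    (hn : Primrec n) (hf : Primrec f) :
    Primrec fun a => badClauses (bad a) (sat a) (n a) (f a) := by
  have hfilter : PrimrecRel fun (g : Fin k → ℕ) (a : α) =>
      ∀ i, g i ≤ f a i ∧ f a i ≤ n a + 1 := by
    refine primrecPred_forall_fin (R := fun (p : (Fin k → ℕ) × α) i =>
      p.1 i ≤ f p.2 i ∧ f p.2 i ≤ n p.2 + 1) ?_
    have happ : Primrec fun p : ((Fin k → ℕ) × α) × Fin k => f p.1.2 p.2 :=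
      primrec_cut_app (hf.comp (snd.comp fst)) snd
    exact (nat_le.comp (primrec_cut_app (fst.comp fst) snd) happ).and
      (nat_le.comp happ (succ.comp (hn.comp (snd.comp fst))))
  refine list_map (g := fun a g => [(true, bad a g), (false, sat a g)])
    (hfilter.listFilter.comp ((primrec_cuts k).comp hn) Primrec.id) ?_
  exact list_cons.comp (Primrec.pair (const _) hbad)
    (primrec_singleton (Primrec.pair (const _) hsat))

theorem primrec_option_elim {β σ : Type*} [Primcodable β] [Primcodable σ] {o : α → Option β}
    {d : α → σ} {g : α → β → σ} (ho : Primrec o) (hd : Primrec d) (hg : Primrec₂ g) :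
    Primrec fun a => (o a).elim (d a) (g a) :=
  (option_casesOn ho hd hg).of_eq fun a => by cases o a <;> rfl

theorem primrec_literal {β : Type*} [Primcodable β] (v : Bool) {b : α → β} (hb : Primrec b) :
    Primrec fun a => (v, b a) :=
  Primrec.pair (const v) hb

theorem primrec_stepSat (e : A ≃ Fin k) {h : α → List ℕ} {f : α → Fin k → ℕ} {t r : α → ℕ}
    (hh : Primrec h) (hf : Primrec f) (ht : Primrec t) (hr : Primrec r) :
    Primrec fun a => stepSat e (h a) (f a) (t a) (r a) := by
  have h₁ : Primrec fun a => (r a).unpair.1 := fst.comp (unpair.comp hr)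
  have h₂ : Primrec fun a => (r a).unpair.2 := snd.comp (unpair.comp hr)
  have hidx : Primrec fun a => agentIdx e (r a).unpair.1 := (primrec_agentIdx e).comp h₁
  have tag : ∀ n, PrimrecPred fun a => t a = n := fun n => Primrec.eq.comp ht (const n)
  refine Primrec.ite (tag 0) ?_ (Primrec.ite (tag 1) ?_ (Primrec.ite (tag 2) ?_
    (Primrec.ite (tag 3) ?_ (Primrec.ite (tag 4) ?_ ?_))))
  · exact Primrec.pair (const _) (primrec_singleton (primrec_singleton
      (primrec_literal _ (primrec_node 0 (const _) (const _) hr))))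
  · exact Primrec.pair (const _) (primrec_singleton (primrec_singleton
      (primrec_literal _ (primrec_node 1 hh hf hr))))
  · exact Primrec.pair (const _) (list_cons.comp
      (primrec_singleton (primrec_literal _ (primrec_node 1 hh hf h₁)))
      (primrec_singleton (primrec_singleton (primrec_literal _ (primrec_node 1 hh hf h₂)))))
  · refine primrec_option_elim hidx (const _)
      (Primrec.pair (option_some.comp (option_some.comp snd)) ?_)
    exact primrec_knowClauses
      (primrec_node 2 (hh.comp (fst.comp fst)) snd (const 0))
      (primrec_node 1 (hh.comp (fst.comp fst)) snd (h₂.comp (fst.comp fst))) (hf.comp fst) snd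
  · exact Primrec.pair (const _) (primrec_singleton (list_cons.comp
      (primrec_literal _ (primrec_node 1 hh hf h₁))
      (primrec_singleton (primrec_literal _ (primrec_node 1 (list_cons.comp h₁ hh) hf h₂)))))
  · refine primrec_option_elim hidx (const _) (Primrec.pair (const _) ?_)
    refine Primrec.ite (nat_lt.comp (primrec_cut_app (hf.comp fst) snd)
      (list_length.comp (hh.comp fst))) (primrec_singleton (primrec_singleton (primrec_literal _ ?_)))
      (const [])
    exact primrec_node 1 (hh.comp fst) (primrec_bumpFin (hf.comp fst) snd) (h₂.comp fst)

theorem primrec_stepBad {h : α → List ℕ} {f : α → Fin k → ℕ} (hh : Primrec h) (hf : Primrec f) :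
    Primrec fun a => stepBad (h a) (f a) := by
  refine list_casesOn (g := fun a => if ∀ i, f a i = 0 then [[]] else [])
    (h := fun a p => badClauses (fun g => ((2, p.2, g, 0) : NodeCode k))
      (fun g => (1, p.2, g, p.1)) p.2.length (f a)) hh (Primrec.ite ?_ (const _) (const _)) ?_
  · exact primrecPred_forall_fin
      (Primrec.eq.comp (primrec_cut_app (hf.comp fst) snd) (const 0))
  · have htail : Primrec fun p : α × ℕ × List ℕ => p.2.2 := snd.comp snd
    exact primrec_badClauses
      (primrec_node 2 (htail.comp fst) snd (const 0))
      (primrec_node 1 (htail.comp fst) snd (fst.comp (snd.comp fst)))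
      (list_length.comp htail) (hf.comp fst)

end

theorem primrec_step (e : A ≃ Fin k) : Primrec (step e) := by
  have hc := unpair.comp (snd.comp (snd.comp (snd.comp (Primrec.id (α := NodeCode k)))))
  have hh : Primrec fun b : NodeCode k => b.2.1 := fst.comp snd
  have hf : Primrec fun b : NodeCode k => b.2.2.1 := fst.comp (snd.comp snd)
  refine Primrec.ite (Primrec.eq.comp fst (const 0)) (const _)
    (Primrec.ite (Primrec.eq.comp fst (const 1)) ?_ ?_)
  · exact primrec_stepSat e hh hf (fst.comp hc) (snd.comp hc)
  · exact Primrec.pair (const _) (primrec_stepBad hh hf)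

end Encoding

/-! ### Recognizing Gödel numbers of formulas -/

section Codes

variable {A : Type v} {P : Type w} [Encodable A]

/-- The numbers that must code formulas for `n` to code a formula. -/
def subcodes (n : ℕ) : List ℕ :=
  if n.unpair.1 = 1 then [n.unpair.2]
  else if n.unpair.1 = 2 ∨ n.unpair.1 = 4 then [n.unpair.2.unpair.1, n.unpair.2.unpair.2]
  else if n.unpair.1 = 3 ∨ n.unpair.1 = 5 then [n.unpair.2.unpair.2]
  else []

/-- The conditions for `n` to code a formula that do not concern the codes of subformulas. -/
def CodeOK (A : Type v) (P : Type w) [Encodable A] [Encodable P] (n : ℕ) : Prop :=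
  n.unpair.1 ≤ 5 ∧
  (n.unpair.1 = 0 → n.unpair.2 ∈ Set.range (Encodable.encode : P → ℕ)) ∧
  (n.unpair.1 = 3 ∨ n.unpair.1 = 5 →
    n.unpair.2.unpair.1 ∈ Set.range (Encodable.encode : A → ℕ))

theorem subcodes_lt {n m : ℕ} (h : m ∈ subcodes n) : m < n := by
  have h₁ := Nat.add_le_pair n.unpair.1 n.unpair.2
  rw [Nat.pair_unpair] at h₁
  have h₂ := Nat.unpair_left_le n.unpair.2
  have h₃ := Nat.unpair_right_le n.unpair.2
  unfold subcodes at h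
  split_ifs at h <;> simp at h <;> omega

theorem exists_code_iff [Encodable P] (n : ℕ) : (∃ φ : Form A P, φ.code = n) ↔
    CodeOK A P n ∧ ∀ m ∈ subcodes n, ∃ φ : Form A P, φ.code = m := by
  constructor
  · rintro ⟨φ, rfl⟩
    cases φ <;> simp [Form.code, CodeOK, subcodes]
  · rintro ⟨⟨h₅, h₀, h₃⟩, hsub⟩
    obtain ⟨t, r, rfl⟩ : ∃ t r, n = Nat.pair t r := ⟨_, _, (Nat.pair_unpair n).symm⟩
    simp only [Nat.unpair_pair, subcodes] at h₅ h₀ h₃ hsub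
    obtain ⟨r₁, r₂, hr⟩ : ∃ r₁ r₂, r = Nat.pair r₁ r₂ := ⟨_, _, (Nat.pair_unpair r).symm⟩
    interval_cases t
    · obtain ⟨p, rfl⟩ := h₀ rfl
      exact ⟨.atom p, rfl⟩
    · obtain ⟨φ, rfl⟩ := hsub r (by simp)
      exact ⟨.neg φ, rfl⟩
    · subst hr
      obtain ⟨φ, rfl⟩ := hsub r₁ (by simp)
      obtain ⟨ψ, rfl⟩ := hsub r₂ (by simp)
      exact ⟨.and φ ψ, rfl⟩
    · subst hr
      obtain ⟨a, ha⟩ := h₃ (by simp)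
      obtain ⟨φ, rfl⟩ := hsub r₂ (by simp)
      exact ⟨.know a φ, by simp [Form.code, ha]⟩
    · subst hr
      obtain ⟨φ, rfl⟩ := hsub r₁ (by simp)
      obtain ⟨ψ, rfl⟩ := hsub r₂ (by simp)
      exact ⟨.ann φ ψ, rfl⟩
    · subst hr
      obtain ⟨a, ha⟩ := h₃ (by simp)
      obtain ⟨φ, rfl⟩ := hsub r₂ (by simp)
      exact ⟨.next a φ, by simp [Form.code, ha]⟩

open Primrec

theorem primrecPred_codeOK [Finite A] [Primcodable P] : PrimrecPred (CodeOK A P) := by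
  have ht : Primrec fun n : ℕ => n.unpair.1 := fst.comp unpair
  have hr : Primrec fun n : ℕ => n.unpair.2 := snd.comp unpair
  have hA : PrimrecPred fun n => n ∈ Set.range (Encodable.encode : A → ℕ) := by
    cases nonempty_fintype A
    refine (primrecPred_mem Primrec.id
      (const ((Finset.univ : Finset A).toList.map Encodable.encode))).of_eq fun n => ?_
    simp
  refine (nat_le.comp ht (const 5)).and (.and ?_ ?_)
  · exact primrecPred_imp (Primrec.eq.comp ht (const 0)) (Primcodable.mem_range_encode.comp hr)
  · exact primrecPred_imp ((Primrec.eq.comp ht (const 3)).or (Primrec.eq.comp ht (const 5)))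
      (hA.comp (ht.comp hr))

theorem primrec_subcodes : Primrec subcodes := by
  have ht : Primrec fun n : ℕ => n.unpair.1 := fst.comp unpair
  have hr : Primrec fun n : ℕ => n.unpair.2 := snd.comp unpair
  have tag : ∀ i, PrimrecPred fun n : ℕ => n.unpair.1 = i := fun i => Primrec.eq.comp ht (const i)
  refine Primrec.ite (tag 1) (primrec_singleton hr)
    (Primrec.ite ((tag 2).or (tag 4)) ?_
      (Primrec.ite ((tag 3).or (tag 5)) (primrec_singleton (hr.comp hr)) (const [])))
  exact list_cons.comp (ht.comp hr) (primrec_singleton (hr.comp hr))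

theorem primrecPred_isCode [Finite A] [Primcodable P] :
    PrimrecPred fun n : ℕ => ∃ φ : Form A P, φ.code = n := by
  classical
  refine Primrec.primrecPred ?_
  refine nat_omega_rec' (m := id) (l := subcodes)
    (g := fun n bs => some (decide (CodeOK A P n ∧ ∀ b ∈ bs, b = true)))
    _ Primrec.id primrec_subcodes ?_ (fun _ _ => subcodes_lt) fun n => ?_
  · refine option_some.comp (PrimrecPred.decide ?_)
    exact (primrecPred_codeOK.comp fst).and
      (primrecPred_forall_mem snd (Primrec.eq.comp snd (const true)))
  · simp only [Option.some_inj, decide_eq_decide, List.forall_mem_map, decide_eq_true_eq]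
    exact (exists_code_iff n).symm

end Codes

/-! ### The decision procedure -/

section Decision

variable {A : Type v} {P : Type w} [Encodable A] {k : ℕ}

/-- The initial node of the formula with Gödel number `n`. -/
def initCode (k n : ℕ) : NodeCode k := (1, [], fun _ => 0, n)

/-- All codes of nodes on which the truth of the formula with Gödel number `n` at initial models
depends. The initial node has measure at most `2 * n + 2` (`Form.weight_le_code`), so the iteration
is long enough to become stationary. -/
def closureCodes (e : A ≃ Fin k) (n : ℕ) : List (NodeCode k) :=
  (expand (step e))^[2 * n + 3] [initCode k n]

theorem Form.weight_le_code [Encodable P] (φ : Form A P) : φ.weight ≤ φ.code + 1 := by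
  induction φ with
  | atom p => simp [Form.weight]
  | neg φ ih =>
    have := Nat.add_le_pair 1 φ.code
    simp only [Form.weight, Form.code]
    omega
  | and φ ψ ih₁ ih₂ =>
    have := Nat.add_le_pair φ.code ψ.code
    have := Nat.add_le_pair 2 (Nat.pair φ.code ψ.code)
    simp only [Form.weight, Form.code]
    omega
  | know a φ ih =>
    have := Nat.right_le_pair (Encodable.encode a) φ.code
    have := Nat.add_le_pair 3 (Nat.pair (Encodable.encode a) φ.code)
    simp only [Form.weight, Form.code]
    omega
  | ann φ ψ ih₁ ih₂ =>
    have := Nat.add_le_pair φ.code ψ.code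
    have := Nat.add_le_pair 4 (Nat.pair φ.code ψ.code)
    simp only [Form.weight, Form.code]
    omega
  | next a φ ih =>
    have := Nat.right_le_pair (Encodable.encode a) φ.code
    have := Nat.add_le_pair 5 (Nat.pair (Encodable.encode a) φ.code)
    simp only [Form.weight, Form.code]
    omega

theorem closureCodes_closed [Encodable P] (e : A ≃ Fin k) (φ : Form A P) :
    ∀ b ∈ closureCodes e φ.code, (∃ n : Node A P k, n.enc = b) ∧
      ∀ b' ∈ (step e b).vars, b' ∈ closureCodes e φ.code := by
  classical
  let μ : NodeCode k → ℕ := fun b =>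
    if h : ∃ n : Node A P k, n.enc = b then h.choose.measure else 0
  have hμ : ∀ n : Node A P k, μ n.enc = n.measure := fun n => by
    have h : ∃ n' : Node A P k, n'.enc = n.enc := ⟨n, rfl⟩
    simp only [μ, dif_pos h]
    rw [Node.enc_injective h.choose_spec]
  have hinit : (Node.sat [] (fun _ => 0) φ : Node A P k).enc = initCode k φ.code := rfl
  refine iterate_expand_closed (μ := μ) ?_ ⟨_, hinit⟩ ?_
  · rintro _ ⟨n, rfl⟩ b' hb'
    rw [vars_step_enc] at hb'
    obtain ⟨n', hn', rfl⟩ := List.mem_map.1 hb'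
    exact ⟨⟨n', rfl⟩, by simpa [hμ] using Node.measure_lt e n n' hn'⟩
  · rw [← hinit, hμ]
    have := φ.weight_le_code
    simp only [Node.measure, List.map_nil, List.sum_nil]
    omega

/-- The epistemic model whose states are the members of a finite family of types. -/
def typeModel [Encodable P] (e : A ≃ Fin k) (C : List (NodeCode k))
    (W : List (List (NodeCode k))) : EpistemicModel.{u, v, w} A P where
  State := ULift.{u} {T // T ∈ W}
  rel a T T' := Agree (step e) C T.down.1 T'.down.1 (some (some (e a)))
  rel_equiv _ := (agree_equivalence C _).comap fun T : ULift.{u} {T // T ∈ W} => T.down.1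
  val p := {T | (Node.atom p : Node A P k).enc ∈ T.down.1}

/-- In the model of a solution, a node from the closure is true at exactly the types that contain
it, because both sides solve the same well-founded system of equations. -/
theorem holds_typeModel_iff [Encodable P] (e : A ≃ Fin k) {C : List (NodeCode k)}
    {W : List (List (NodeCode k))} (hC : ∀ b ∈ C, ∀ b' ∈ (step e b).vars, b' ∈ C)
    (hW : IsSolution (step e) C W) (n : Node A P k) (hn : n.enc ∈ C)
    (T : ULift.{u} {T // T ∈ W}) :
    n.Holds e (typeModel e C W) T ↔ n.enc ∈ T.down.1 := by
  induction hm : n.measure using Nat.strong_induction_on generalizing n T with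
  | _ m ih =>
    subst hm
    have hvars := hC _ hn
    rw [vars_step_enc] at hvars
    have hcl : ∀ T : ULift.{u} {T // T ∈ W},
        (n.eqn e).2.Holds (Node.Holds e (typeModel e C W) T) ↔
          (n.eqn e).2.Holds (fun n' => n'.enc ∈ T.down.1) := fun T =>
      Clauses.holds_congr fun n' hn' => ih _ (Node.measure_lt e n n' hn') n'
        (hvars _ (List.mem_map_of_mem hn')) T rfl
    have h₁ : (n.eqn e).Solved
        (fun i (T T' : ULift.{u} {T // T ∈ W}) =>
          Agree (step e) C T.down.1 T'.down.1 (some (some i)))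
        (Node.Holds e (typeModel e C W)) n := by
      convert Node.solved e (typeModel.{u} e C W) n using 4
      simp [typeModel]
    have h₂ := hW.solved hn
    rw [step_enc, Equation.solved_map] at h₂
    rcases hk : n.eqn e with ⟨_ | _ | i, c⟩
    · cases n with
      | atom p => exact Iff.rfl
      | sat h f φ => cases φ <;> simp [Node.eqn] at hk
      | bad h f => cases h <;> simp [Node.eqn] at hk
    · rw [hk] at h₁ h₂ hcl
      exact (h₁ T).trans ((hcl T).trans (h₂ T.down).symm)
    · rw [hk] at h₁ h₂ hcl
      refine (h₁ T).trans (Iff.trans ?_ (h₂ T.down).symm)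
      exact ⟨fun H T' hT' => (hcl ⟨T'⟩).1 (H ⟨T'⟩ hT'),
        fun H T' hT' => (hcl T').2 (H T'.down hT')⟩

/-- A formula is valid on initial models if and only if no finite family of types refutes it. -/
theorem validInit_iff [Encodable P] (e : A ≃ Fin k) (φ : Form A P) :
    ValidInit.{u, v, w} φ ↔
      ¬ Refutable (step e) (closureCodes e φ.code) (initCode k φ.code) := by
  have hclosed := closureCodes_closed e φ
  have hC := fun b hb => (hclosed b hb).2
  have hmem : (Node.sat [] (fun _ => 0) φ : Node A P k).enc ∈ closureCodes e φ.code :=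
    mem_iterate_expand_self _ _
  constructor
  · rintro hval ⟨W, -, hW, T, hT, hφ⟩
    exact hφ ((holds_typeModel_iff e hC hW _ hmem ⟨⟨T, hT⟩⟩).1 (hval (typeModel e _ W) _))
  · intro hnot M s
    by_contra hs
    let H : M.State → NodeCode k → Prop := fun s b =>
      ∃ n : Node A P k, n.enc = b ∧ n.Holds e M s
    have hH : ∀ s (n : Node A P k), H s n.enc ↔ n.Holds e M s := fun s n =>
      ⟨fun ⟨n', h, h'⟩ => Node.enc_injective h ▸ h', fun h => ⟨n, rfl, h⟩⟩
    refine hnot (refutable_of_solved (R := fun i => M.rel (e.symm i)) (H := H)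
      (fun i => M.rel_equiv _) hC ?_ hmem (x := s) fun h => hs ((hH s (.sat [] (fun _ => 0) φ)).1 h))
    intro b hb
    obtain ⟨n, rfl⟩ := (hclosed b hb).1
    rw [step_enc, Equation.solved_map]
    simp only [hH]
    exact Node.solved e M n

theorem primrecPred_refutable_code (e : A ≃ Fin k) : PrimrecPred fun n : ℕ =>
    Refutable (step e) (closureCodes e n) (initCode k n) := by
  have hinit : Primrec (initCode k) := primrec_node 1 (.const _) (.const _) .id
  refine primrecPred_refutable (primrec_step e) ?_ hinit
  refine Primrec.nat_iterate (h := fun _ L => expand (step e) L) ?_ (primrec_singleton hinit)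
    ((primrec_expand (primrec_step e)).comp .snd)
  exact Primrec.nat_add.comp (Primrec.nat_mul.comp (.const 2) .id) (.const 3)

end Decision

end AsyncAnnouncement

/-- For every finite set of agents and every (effectively) countable set of propositional
variables, the set of Gödel numbers of formulas of asynchronous announcement logic that are valid
on the class of initial asynchronous models is recursive. -/
theorem mainTheorem2 (A : Type v) (P : Type w) [Finite A] [Encodable A] [Primcodable P] :
    ComputablePred (fun n : ℕ => ∃ φ : AsyncAnnouncement.Form A P,
      φ.code = n ∧ AsyncAnnouncement.ValidInit.{u, v, w} φ) := by
  obtain ⟨k, ⟨e⟩⟩ := Finite.exists_equiv_fin A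
  refine (((AsyncAnnouncement.primrecPred_isCode (A := A) (P := P)).and
    (AsyncAnnouncement.primrecPred_refutable_code e).not).of_eq fun n => ?_).computablePred
  constructor
  · rintro ⟨⟨φ, rfl⟩, h⟩
    exact ⟨φ, rfl, (AsyncAnnouncement.validInit_iff e φ).2 h⟩
  · rintro ⟨φ, rfl, h⟩
    exact ⟨⟨φ, rfl⟩, (AsyncAnnouncement.validInit_iff e φ).1 h⟩
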